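/- Let $S$ be a commutative semigroup, written multiplicatively, with neutral element $1$ and an involution $*$ (so $(st)^*=s^*t^*$, $(s^*)^*=s$, $1^*=1$). The semigroup ring $\mathbb{C}[S]$ of finite sums $f=\sum_s f_s s$, $f_s\in\mathbb{C}$, carries the involution $f^*=\sum_s \overline{f_s}\,s^*$; let $A_S=\{f\in\mathbb{C}[S] : f^*=f\}$ be the $\mathbb{R}$-algebra of symmetric elements. A semicharacter of $S$ is a map $\alpha:S\to\mathbb{C}$ with $\alpha(1)=1$, $\alpha(st)=\alpha(s)\alpha(t)$ and $\alpha(s^*)=\overline{\alpha(s)}$ for all $s,t\in S$; it induces a ring homomorphism $A_S\to\mathbb{R}$, $f\mapsto \alpha(f):=\sum_s f_s\alpha(s)$. Let $\phi:S\to\mathbb{R}_{\ge 0}$ be an absolute value, i.e. $\phi(1)\ge 1$, $\phi(st)\le\phi(s)\phi(t)$ and $\phi(s^*)=\phi(s)$ for all $s,t\in S$. Let $\|f\|_\phi=\sum_s|f_s|\phi(s)$ be the $\phi$-seminorm, let $\mathcal{K}_\phi$ be the set of semicharacters $\alpha$ of $S$ with $|\alpha(s)|\le\phi(s)$ for all $s\in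 S$, and let $\operatorname{Pos}(\mathcal{K}_\phi)=\{f\in A_S : \alpha(f)\ge 0 \text{ for all } \alpha\in\mathcal{K}_\phi\}$. **Theorem.** For every integer $d\ge 1$, the closure in $A_S$, in the topology induced by the $\phi$-seminorm, of the cone $\sum A_S^{2d}$ of all finite sums of $2d$-th powers of elements of $A_S$ is equal to $\operatorname{Pos}(\mathcal{K}_\phi)$. -/

import Mathlib

open scoped NNReal

noncomputable section

/-- The semigroup ring `ℂ[S]`. -/
abbrev SemigroupRing (S : Type*) : Type _ := MonoidAlgebra ℂ S

namespace SemigroupRing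

/-- The `φ`-seminorm `‖f‖_φ = ∑ |f_s| φ(s)` on `ℂ[S]`. -/
def phiSeminorm {S : Type*} (φ : S → ℝ≥0) : Seminorm ℂ (SemigroupRing S) :=
  Seminorm.of (fun f => f.coeff.sum fun s z => ‖z‖ * (φ s : ℝ))
    (fun f g => by
      classical
      have key : ∀ h : SemigroupRing S, h.coeff.support ⊆ f.coeff.support ∪ g.coeff.support →
          (h.coeff.sum fun s z => ‖z‖ * (φ s : ℝ)) =
            ∑ s ∈ f.coeff.support ∪ g.coeff.support, ‖h.coeff s‖ * (φ s : ℝ) :=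
        fun h hh => Finsupp.sum_of_support_subset _ hh _ (by simp)
      rw [key f Finset.subset_union_left, key g Finset.subset_union_right,
        key (f + g) (by rw [MonoidAlgebra.coeff_add]; exact Finsupp.support_add),
        ← Finset.sum_add_distrib]
      refine Finset.sum_le_sum fun s _ => ?_
      rw [← add_mul, MonoidAlgebra.coeff_add, Finsupp.add_apply]
      exact mul_le_mul_of_nonneg_right (norm_add_le _ _) (φ s).coe_nonneg)
    (fun c f => by
      rw [MonoidAlgebra.coeff_smul, Finsupp.sum_of_support_subset _ Finsupp.support_smul _ (by simp),
        Finsupp.sum, Finset.mul_sum]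
      exact Finset.sum_congr rfl fun s _ => by simp [mul_assoc])

theorem phiSeminorm_apply {S : Type*} (φ : S → ℝ≥0) (f : SemigroupRing S) :
    phiSeminorm φ f = f.coeff.sum fun s z => ‖z‖ * (φ s : ℝ) := rfl

variable {S : Type*} [CommMonoid S] [StarMul S]

/-- The involution `f = ∑ f_s s ↦ ∑ conj (f_s) s*` of `ℂ[S]`, as an additive map. -/
def starAddHom : SemigroupRing S →+ SemigroupRing S where
  toFun f := f.coeff.sum fun s z => MonoidAlgebra.single (star s) (star z)
  map_zero' := by simp
  map_add' f g := by
    rw [MonoidAlgebra.coeff_add, Finsupp.sum_add_index'] <;> simp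

theorem starAddHom_single (s : S) (z : ℂ) :
    starAddHom (MonoidAlgebra.single s z) = MonoidAlgebra.single (star s) (star z) := by
  simp [starAddHom]

theorem starAddHom_involutive (f : SemigroupRing S) : starAddHom (starAddHom f) = f := by
  induction f using MonoidAlgebra.induction_linear with
  | zero => simp
  | add f g hf hg => simp [hf, hg]
  | single s z => simp [starAddHom_single]

theorem starAddHom_mul (f g : SemigroupRing S) :
    starAddHom (f * g) = starAddHom g * starAddHom f := by
  induction f using MonoidAlgebra.induction_linear with
  | zero => simp
  | add f f' hf hf' => simp [add_mul, mul_add, hf, hf']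
  | single s z =>
    induction g using MonoidAlgebra.induction_linear with
    | zero => simp
    | add g g' hg hg' => simp [add_mul, mul_add, hg, hg']
    | single t w =>
      rw [MonoidAlgebra.single_mul_single, starAddHom_single, starAddHom_single, starAddHom_single,
        MonoidAlgebra.single_mul_single, star_mul, star_mul]

/-- `ℂ[S]` with its involution is a `*`-ring. -/
instance instStarRing : StarRing (SemigroupRing S) where
  star f := starAddHom f
  star_involutive f := starAddHom_involutive f
  star_mul f g := starAddHom_mul f g
  star_add f g := map_add _ f g

theorem star_def (f : SemigroupRing S) :
    star f = f.coeff.sum fun s z => MonoidAlgebra.single (star s) (star z) := rfl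

theorem star_single (s : S) (z : ℂ) :
    star (MonoidAlgebra.single s z : SemigroupRing S) =
      MonoidAlgebra.single (star s) (star z) :=
  starAddHom_single s z

instance instStarModule : StarModule ℂ (SemigroupRing S) where
  star_smul c f := by
    induction f using MonoidAlgebra.induction_linear with
    | zero => simp
    | add f g hf hg => simp only [smul_add, star_add, hf, hg]
    | single s z => simp [star_single, MonoidAlgebra.smul_single]

end SemigroupRing

/-- The `ℝ`-algebra `A_S` of symmetric elements `f = f*` of `ℂ[S]`. -/
def SymmetricPart (S : Type*) [CommMonoid S] [StarMul S] : Subalgebra ℝ (SemigroupRing S) where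
  carrier := {f | star f = f}
  mul_mem' {f g} hf hg := by
    change star _ = _
    change star f = f at hf
    change star g = g at hg
    rw [star_mul, hf, hg, mul_comm]
  add_mem' {f g} hf hg := by
    change star _ = _
    change star f = f at hf
    change star g = g at hg
    rw [star_add, hf, hg]
  algebraMap_mem' r := by
    simp [SemigroupRing.star_single, MonoidAlgebra.coe_algebraMap]

namespace SymmetricPart

variable {S : Type*} [CommMonoid S] [StarMul S]

/-- The restriction of the `φ`-seminorm to `A_S`. -/
def phiSeminorm (φ : S → ℝ≥0) : Seminorm ℝ (SymmetricPart S) :=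
  ((SemigroupRing.phiSeminorm φ).restrictScalars ℝ).comp (SymmetricPart S).val.toLinearMap

theorem phiSeminorm_apply (φ : S → ℝ≥0) (f : SymmetricPart S) :
    phiSeminorm φ f = (f : SemigroupRing S).coeff.sum fun s z => ‖z‖ * (φ s : ℝ) := rfl

/-- The (not necessarily Hausdorff) topology on `A_S` induced by the `φ`-seminorm. -/
@[reducible] def phiTopology (φ : S → ℝ≥0) : TopologicalSpace (SymmetricPart S) :=
  (phiSeminorm φ).toSeminormedAddCommGroup.toUniformSpace.toTopologicalSpace

end SymmetricPart

/-- Semicharacters of `S`: maps `α : S → ℂ` with `α 1 = 1`, `α (s * t) = α s * α t` and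
`α (s*) = conj (α s)`. -/
structure Semicharacter (S : Type*) [CommMonoid S] [StarMul S] extends S →* ℂ where
  map_star' : ∀ s, toFun (star s) = star (toFun s)

namespace Semicharacter

variable {S : Type*} [CommMonoid S] [StarMul S]

/-- The `*`-algebra homomorphism `ℂ[S] → ℂ`, `f ↦ ∑ f_s α(s)`, attached to a semicharacter. -/
def toStarAlgHom (α : Semicharacter S) : SemigroupRing S →⋆ₐ[ℂ] ℂ where
  __ := MonoidAlgebra.lift ℂ ℂ S α.toMonoidHom
  map_star' f := by
    change MonoidAlgebra.lift ℂ ℂ S α.toMonoidHom (star f) =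
      star (MonoidAlgebra.lift ℂ ℂ S α.toMonoidHom f)
    induction f using MonoidAlgebra.induction_linear with
    | zero => simp
    | add f g hf hg => rw [star_add, map_add, map_add, star_add, hf, hg]
    | single s z =>
      rw [SemigroupRing.star_single, MonoidAlgebra.lift_single, MonoidAlgebra.lift_single,
        smul_eq_mul, smul_eq_mul, star_mul']
      exact congrArg _ (α.map_star' s)

theorem toStarAlgHom_apply (α : Semicharacter S) (f : SemigroupRing S) :
    α.toStarAlgHom f = f.coeff.sum fun s z => z * α.toMonoidHom s := by
  change MonoidAlgebra.lift ℂ ℂ S α.toMonoidHom f = _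
  simp [MonoidAlgebra.lift_apply]

theorem toStarAlgHom_im (α : Semicharacter S) (f : SymmetricPart S) :
    (α.toStarAlgHom (f : SemigroupRing S)).im = 0 := by
  refine Complex.conj_eq_iff_im.mp ?_
  have h : star (f : SemigroupRing S) = f := f.2
  have := map_star α.toStarAlgHom (f : SemigroupRing S)
  rw [h] at this
  exact this.symm

/-- The ring homomorphism `A_S → ℝ`, `f ↦ ∑ f_s α(s)`, attached to a semicharacter `α`. -/
def eval (α : Semicharacter S) : SymmetricPart S →+* ℝ where
  toFun f := (α.toStarAlgHom (f : SemigroupRing S)).re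
  map_one' := by simp
  map_zero' := by simp
  map_add' f g := by simp
  map_mul' f g := by simp [toStarAlgHom_im]

theorem coe_eval (α : Semicharacter S) (f : SymmetricPart S) :
    (α.eval f : ℂ) = (f : SemigroupRing S).coeff.sum fun s z => z * α.toMonoidHom s := by
  rw [← toStarAlgHom_apply]
  exact Complex.ext rfl (by simp [toStarAlgHom_im])

/-- `K_φ`, the set of semicharacters `α` with `|α(s)| ≤ φ(s)` for all `s`. -/
def boundedBy (φ : S → ℝ≥0) : Set (Semicharacter S) :=
  {α | ∀ s, ‖α.toMonoidHom s‖ ≤ φ s}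

/-- `Pos(K)`, the set of elements of `A_S` that are non-negative on `K`. -/
def Pos (K : Set (Semicharacter S)) : Set (SymmetricPart S) :=
  {f | ∀ α ∈ K, 0 ≤ α.eval f}

end Semicharacter

/-- Absolute values on `S`. -/
structure IsSemigroupAbsoluteValue {S : Type*} [CommMonoid S] [StarMul S] (φ : S → ℝ≥0) :
    Prop where
  one_le : 1 ≤ φ 1
  map_mul_le : ∀ s t, φ (s * t) ≤ φ s * φ t
  map_star : ∀ s, φ (star s) = φ s

/-- `∑ A^k`, the set of all finite sums of `k`-th powers of elements of `A`. -/
def sumsOfPowers (A : Type*) [CommSemiring A] (k : ℕ) : Set A :=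
  AddSubmonoid.closure (Set.range fun a : A => a ^ k)

end

/-!
One inclusion is soft: a semicharacter in `K_φ` is a contraction for the `φ`-seminorm and maps
`2d`-th powers to nonnegative reals, so `Pos(K_φ)` is a closed set containing all sums of `2d`-th
powers.

For the other inclusion, `A_S` with the `φ`-seminorm is treated as a commutative seminormed
`ℝ`-algebra `A`, and `T` denotes the closure of the sums of `2d`-th powers. This `T` is a closed
subsemiring containing the nonnegative scalars. Since `y ↦ y ^ (2d)` is open at `1` on the
completion of `A`, by the inverse function theorem, `T` is a neighbourhood of `1`
(`closure_range_pow_mem_nhds_one`), which makes it archimedean: every `a` satisfies `c ± a ∈ T`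
for some scalar `c`. Two consequences follow.

* The normalized functionals that are nonnegative on `T` form a compact convex set, and its extreme
  points are multiplicative (`map_mul_of_mem_extremePoints`), because a state `g` is a convex
  combination of the states `x ↦ g (t * x) / g t` and `x ↦ g ((1 - t) * x) / (1 - g t)` whenever
  `t, 1 - t ∈ T` and `0 < g t < 1`.
* An extreme state is therefore a character that is bounded on the unit ball, hence a contraction
  (`abs_map_le_norm_of_bounded`).

If `f ∉ T`, the Hahn-Banach theorem gives a state that is negative at `f`, and by the Krein-Milman
theorem some extreme state is negative at `f` as well. Hence `T` contains every element that is
nonnegative under all contractive characters (`mem_of_forall_contractive_algHom_nonneg`). Finally,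
the contractive characters of `A_S` come from `K_φ`: they extend `ℂ`-linearly to `ℂ[S]`, and the
bound `|α(s)| ≤ φ(s)` is read off from the symmetric element `(u s + (u s)*) / 2` for a suitable
phase `u` (`SymmetricPart.toSemicharacter_mem_boundedBy`).
-/

noncomputable section

open Filter Topology

/-! ### States on an archimedean subsemiring -/

section States

variable {A : Type*} [CommRing A] [Algebra ℝ A]

/-- The normalized `ℝ`-linear functionals on `A` that are nonnegative on `T`, encoded as plain
functions so that the set lives in the product space `A → ℝ`. -/
def stateSpace (T : Set A) : Set (A → ℝ) :=
  {g | (∀ a b, g (a + b) = g a + g b) ∧ (∀ (r : ℝ) (a : A), g (r • a) = r * g a) ∧ g 1 = 1 ∧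
    ∀ t ∈ T, 0 ≤ g t}

theorem isClosed_stateSpace (T : Set A) : IsClosed (stateSpace T) := by
  simp only [stateSpace, Set.ofPred_and, Set.ofPred_forall]
  refine IsClosed.inter ?_ (IsClosed.inter ?_ (IsClosed.inter ?_ ?_))
  · exact isClosed_iInter fun a => isClosed_iInter fun b => isClosed_eq (by fun_prop) (by fun_prop)
  · exact isClosed_iInter fun a => isClosed_iInter fun b => isClosed_eq (by fun_prop) (by fun_prop)
  · exact isClosed_eq (by fun_prop) (by fun_prop)
  · exact isClosed_iInter fun a => isClosed_iInter fun _ => isClosed_le (by fun_prop) (by fun_prop)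

theorem convex_stateSpace (T : Set A) : Convex ℝ (stateSpace T) := by
  rintro g ⟨g1, g2, g3, g4⟩ h ⟨h1, h2, h3, h4⟩ a b ha hb hab
  refine ⟨fun x y => ?_, fun r x => ?_, ?_, fun t ht => ?_⟩
  · simp [g1, h1]; ring
  · simp [g2, h2]; ring
  · simp [g3, h3, hab]
  · exact add_nonneg (mul_nonneg ha (g4 t ht)) (mul_nonneg hb (h4 t ht))

theorem abs_le_of_mem_stateSpace {T : Set A} {g : A → ℝ} (hg : g ∈ stateSpace T) {a : A} {c : ℝ}
    (h₁ : algebraMap ℝ A c + a ∈ T) (h₂ : algebraMap ℝ A c - a ∈ T) : |g a| ≤ c := by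
  obtain ⟨g1, g2, g3, g4⟩ := hg
  have hc : g (algebraMap ℝ A c) = c := by rw [Algebra.algebraMap_eq_smul_one, g2, g3, mul_one]
  have hn : g (-a) = -g a := by rw [← neg_one_smul ℝ a, g2]; ring
  have e₁ := g4 _ h₁
  have e₂ := g4 _ h₂
  rw [g1, hc] at e₁
  rw [sub_eq_add_neg, g1, hc, hn] at e₂
  exact abs_le.2 ⟨by linarith, by linarith⟩

variable (T : Subsemiring A)

/-- `T` is archimedean if every element of `A` is dominated, up to sign, by a scalar. -/
def IsArchimedeanSubsemiring : Prop :=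
  ∀ a : A, ∃ c : ℝ, 0 < c ∧ algebraMap ℝ A c + a ∈ T ∧ algebraMap ℝ A c - a ∈ T

variable {T}

theorem isCompact_stateSpace (hT : IsArchimedeanSubsemiring T) :
    IsCompact (stateSpace (T : Set A)) := by
  choose c _ hc₁ hc₂ using hT
  refine (isCompact_univ_pi fun a => isCompact_Icc (a := -c a) (b := c a)).of_isClosed_subset
    (isClosed_stateSpace _) fun g hg a _ => ?_
  exact abs_le.1 (abs_le_of_mem_stateSpace hg (hc₁ a) (hc₂ a))

/-- If `t` and `1 - t` lie in `T`, then `g` is the convex combination with weights `g t` and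
`1 - g t` of the states `x ↦ g (t * x) / g t` and `x ↦ g ((1 - t) * x) / (1 - g t)`. -/
theorem map_mul_of_mem_extremePoints_of_mem {g : A → ℝ}
    (hg : g ∈ (stateSpace (T : Set A)).extremePoints ℝ) {t : A} (ht : t ∈ T) (ht' : 1 - t ∈ T)
    (h0 : 0 < g t) (h1 : g t < 1) (x : A) : g (t * x) = g t * g x := by
  have hK := hg.1
  obtain ⟨g1, g2, g3, g4⟩ := hK
  have hcond : ∀ s ∈ T, 0 < g s → (fun x => (g s)⁻¹ * g (s * x)) ∈ stateSpace (T : Set A) := by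
    intro s hs hs0
    refine ⟨fun a b => ?_, fun r a => ?_, ?_, fun a ha => ?_⟩
    · simp only [mul_add, g1]
    · simp only [mul_smul_comm, g2]; ring
    · simp [hs0.ne']
    · exact mul_nonneg (inv_nonneg.2 hs0.le) (g4 _ (T.mul_mem hs ha))
  have hsub : g (1 - t) = 1 - g t := by
    have := g1 (1 - t) t
    rw [sub_add_cancel, g3] at this
    linarith
  have h1' : 0 < g (1 - t) := by rw [hsub]; linarith
  have hseg : g ∈ openSegment ℝ (fun x => (g t)⁻¹ * g (t * x))
      (fun x => (g (1 - t))⁻¹ * g ((1 - t) * x)) := by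
    refine ⟨g t, g (1 - t), h0, h1', by rw [hsub]; ring, ?_⟩
    ext y
    have := g1 (t * y) ((1 - t) * y)
    rw [← add_mul, add_sub_cancel, one_mul] at this
    simp only [Pi.add_apply, Pi.smul_apply, smul_eq_mul]
    rw [mul_inv_cancel_left₀ h0.ne', mul_inv_cancel_left₀ h1'.ne', this]
  have := congrFun (hg.2 (hcond t ht h0) (hcond _ ht' h1') hseg) x
  rw [← this, mul_inv_cancel_left₀ h0.ne']

theorem map_mul_of_mem_extremePoints (hr : ∀ r : ℝ, 0 ≤ r → algebraMap ℝ A r ∈ T)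
    (hT : IsArchimedeanSubsemiring T) {g : A → ℝ}
    (hg : g ∈ (stateSpace (T : Set A)).extremePoints ℝ) (a x : A) : g (a * x) = g a * g x := by
  obtain ⟨c, hc, h₁, h₂⟩ := hT a
  have hb := abs_le.1 (abs_le_of_mem_stateSpace hg.1 h₁ h₂)
  obtain ⟨g1, g2, g3, g4⟩ := hg.1
  -- The shift by `1 / 2` keeps `g t` in `[1 / 4, 3 / 4]`, away from the degenerate weights.
  set t : A := (1 / 2 : ℝ) • 1 + (1 / (4 * c)) • a with ht
  have hgt : g t = 1 / 2 + g a / (4 * c) := by rw [ht, g1, g2, g2, g3]; ring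
  have hlo : -(1 / 4) ≤ g a / (4 * c) := by rw [le_div_iff₀ (by positivity)]; linarith
  have hhi : g a / (4 * c) ≤ 1 / 4 := by rw [div_le_iff₀ (by positivity)]; linarith
  have hsm : ∀ s ∈ T, ∀ r : ℝ, 0 ≤ r → r • s ∈ T := fun s hs r h => by
    rw [Algebra.smul_def]; exact T.mul_mem (hr r h) hs
  have key : ∀ b : A, algebraMap ℝ A c + b ∈ T → (1 / 2 : ℝ) • (1 : A) + (1 / (4 * c)) • b ∈ T := by
    intro b h
    have e : (1 / 2 : ℝ) • (1 : A) + (1 / (4 * c)) • b =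
        algebraMap ℝ A (1 / 4) + (1 / (4 * c)) • (algebraMap ℝ A c + b) := by
      rw [Algebra.algebraMap_eq_smul_one, Algebra.algebraMap_eq_smul_one, smul_add, smul_smul,
        ← add_assoc, ← add_smul]
      congr 2
      field_simp
      norm_num
    rw [e]
    exact T.add_mem (hr _ (by norm_num)) (hsm _ h _ (by positivity))
  have ht' : 1 - t = (1 / 2 : ℝ) • 1 + (1 / (4 * c)) • (-a) := by
    rw [ht, smul_neg]
    have : (1 : A) = (1 / 2 : ℝ) • 1 + (1 / 2 : ℝ) • 1 := by rw [← add_smul]; norm_num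
    nth_rewrite 1 [this]
    abel
  have hmul := map_mul_of_mem_extremePoints_of_mem hg (key a h₁)
    (by rw [ht']; exact key (-a) (by rwa [← sub_eq_add_neg]))
    (by rw [hgt]; linarith) (by rw [hgt]; linarith) x
  have hl : g (t * x) = 1 / 2 * g x + 1 / (4 * c) * g (a * x) := by
    rw [ht, add_mul, smul_mul_assoc, smul_mul_assoc, one_mul, g1, g2, g2]
  rw [← ht, hl, hgt] at hmul
  field_simp at hmul
  linarith

/-- An extreme state, as an algebra homomorphism. -/
def algHomOfExtremeState (hr : ∀ r : ℝ, 0 ≤ r → algebraMap ℝ A r ∈ T)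
    (hT : IsArchimedeanSubsemiring T) {g : A → ℝ}
    (hg : g ∈ (stateSpace (T : Set A)).extremePoints ℝ) : A →ₐ[ℝ] ℝ :=
  AlgHom.ofLinearMap ⟨⟨g, hg.1.1⟩, hg.1.2.1⟩ hg.1.2.2.1 (map_mul_of_mem_extremePoints hr hT hg)

end States

/-! ### Representation theorem for seminormed algebras -/

section Seminormed

variable {A : Type*} [SeminormedCommRing A] [NormedAlgebra ℝ A]

theorem exists_pos_forall_add_mem_of_mem_nhds_one {T : Subsemiring A}
    (hr : ∀ r : ℝ, 0 ≤ r → algebraMap ℝ A r ∈ T) (h1 : (T : Set A) ∈ 𝓝 1) :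
    ∃ δ : ℝ, 0 < δ ∧ ∀ (a : A) (c : ℝ), 0 < c → ‖a‖ < c * δ → algebraMap ℝ A c + a ∈ T := by
  obtain ⟨δ, hδ, hball⟩ := Metric.mem_nhds_iff.1 h1
  refine ⟨δ, hδ, fun a c hc hac => ?_⟩
  have h : 1 + c⁻¹ • a ∈ T := by
    apply hball
    rw [mem_ball_iff_norm, add_sub_cancel_left, norm_smul, norm_inv, Real.norm_of_nonneg hc.le,
      inv_mul_lt_iff₀ hc]
    exact hac
  have := T.mul_mem (hr c hc.le) h
  rwa [← Algebra.smul_def, smul_add, smul_inv_smul₀ hc.ne', ← Algebra.algebraMap_eq_smul_one]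
    at this

theorem isArchimedeanSubsemiring_of_mem_nhds_one {T : Subsemiring A}
    (hr : ∀ r : ℝ, 0 ≤ r → algebraMap ℝ A r ∈ T) (h1 : (T : Set A) ∈ 𝓝 1) :
    IsArchimedeanSubsemiring T := by
  intro a
  obtain ⟨δ, hδ, h⟩ := exists_pos_forall_add_mem_of_mem_nhds_one hr h1
  have hc : 0 < (‖a‖ + 1) / δ := by positivity
  have ha : ‖a‖ < (‖a‖ + 1) / δ * δ := by rw [div_mul_cancel₀ _ hδ.ne']; linarith
  exact ⟨_, hc, h a _ hc ha, by rw [sub_eq_add_neg]; exact h (-a) _ hc (by rwa [norm_neg])⟩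

/-- A character that is bounded on the unit ball is contractive: otherwise the powers of some
`b` with `‖b‖ < 1 < |α b|` would be unbounded under `α`. -/
theorem abs_map_le_norm_of_bounded (α : A →ₐ[ℝ] ℝ) {C : ℝ}
    (hC : ∀ a : A, ‖a‖ ≤ 1 → |α a| ≤ C) (a : A) : |α a| ≤ ‖a‖ := by
  by_contra! h
  obtain ⟨s, hs, hs'⟩ := exists_between h
  have hs0 : 0 < s := (norm_nonneg a).trans_lt hs
  set b : A := s⁻¹ • a with hb
  have hb1 : ‖b‖ ≤ 1 := by
    rw [hb, norm_smul, norm_inv, Real.norm_of_nonneg hs0.le, inv_mul_le_iff₀ hs0, mul_one]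
    exact hs.le
  have hαb : 1 < |α b| := by
    rw [hb, map_smul, smul_eq_mul, abs_mul, abs_of_pos (inv_pos.2 hs0), lt_inv_mul_iff₀ hs0, mul_one]
    exact hs'
  obtain ⟨n, hn⟩ := pow_unbounded_of_one_lt C hαb
  have hn' : |α b| ^ n ≤ |α b| ^ (n + 1) := pow_le_pow_right₀ hαb.le n.le_succ
  have := hC (b ^ (n + 1)) ((norm_pow_le' b n.succ_pos).trans (pow_le_one₀ (norm_nonneg b) hb1))
  rw [map_pow, abs_pow] at this
  linarith

/-- A closed subsemiring that contains the nonnegative scalars and is a neighbourhood of `1`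
contains every element on which all contractive characters are nonnegative. -/
theorem mem_of_forall_contractive_algHom_nonneg {T : Subsemiring A} (hcl : IsClosed (T : Set A))
    (hr : ∀ r : ℝ, 0 ≤ r → algebraMap ℝ A r ∈ T) (h1 : (T : Set A) ∈ 𝓝 1) {f : A}
    (hf : ∀ α : A →ₐ[ℝ] ℝ, (∀ a, |α a| ≤ ‖a‖) → 0 ≤ α f) : f ∈ T := by
  have hT := isArchimedeanSubsemiring_of_mem_nhds_one hr h1
  have hsm : ∀ s ∈ T, ∀ r : ℝ, 0 ≤ r → r • s ∈ T := fun s hs r h => by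
    rw [Algebra.smul_def]; exact T.mul_mem (hr r h) hs
  have hconv : Convex ℝ (T : Set A) := fun x hx y hy a b ha hb _ =>
    T.add_mem (hsm x hx a ha) (hsm y hy b hb)
  by_contra hfT
  obtain ⟨ℓ, u, hfu, hu⟩ := geometric_hahn_banach_point_closed hconv hcl hfT
  have hu0 : u < 0 := by simpa using hu 0 T.zero_mem
  have hpos : ∀ t ∈ T, 0 ≤ ℓ t := by
    intro t ht
    by_contra! hlt
    have := hu _ (hsm t ht (u / ℓ t) (div_nonneg_of_nonpos hu0.le hlt.le))
    rw [map_smul, smul_eq_mul, div_mul_cancel₀ _ hlt.ne] at this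
    exact this.false
  have hℓ1 : 0 < ℓ 1 := by
    obtain ⟨c, hc, h, -⟩ := hT f
    have := hpos _ h
    rw [map_add, Algebra.algebraMap_eq_smul_one, map_smul, smul_eq_mul] at this
    exact pos_of_mul_pos_right (a := c) (by linarith) hc.le
  have hg : (fun a => (ℓ 1)⁻¹ * ℓ a) ∈ stateSpace (T : Set A) := by
    refine ⟨fun a b => ?_, fun r a => ?_, ?_, fun t ht => ?_⟩
    · simp only [map_add]; ring
    · simp only [map_smul, smul_eq_mul]; ring
    · exact inv_mul_cancel₀ hℓ1.ne'
    · exact mul_nonneg (inv_nonneg.2 hℓ1.le) (hpos t ht)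
  obtain ⟨δ, hδ, hδT⟩ := exists_pos_forall_add_mem_of_mem_nhds_one hr h1
  have hext : (stateSpace (T : Set A)).extremePoints ℝ ⊆ {g | 0 ≤ g f} := by
    intro e he
    refine hf (algHomOfExtremeState hr hT he) (abs_map_le_norm_of_bounded _ (C := 2 / δ) ?_)
    intro a ha
    have hlt : ‖a‖ < 2 / δ * δ := by rw [div_mul_cancel₀ _ hδ.ne']; linarith
    exact abs_le_of_mem_stateSpace he.1 (hδT a _ (by positivity) hlt)
      (by rw [sub_eq_add_neg]; exact hδT (-a) _ (by positivity) (by rwa [norm_neg]))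
  have hsub : stateSpace (T : Set A) ⊆ {g | 0 ≤ g f} := by
    rw [← closure_convexHull_extremePoints (isCompact_stateSpace hT) (convex_stateSpace _)]
    refine closure_minimal (convexHull_min hext ?_) (isClosed_le (by fun_prop) (by fun_prop))
    intro x hx y hy a b ha hb _
    exact add_nonneg (mul_nonneg ha hx) (mul_nonneg hb hy)
  have := nonneg_of_mul_nonneg_right (hsub hg) (inv_pos.2 hℓ1)
  linarith

/-! ### The closure of the sums of powers -/

/-- In the completion, `y ↦ y ^ k` is open at `1` by the inverse function theorem, and roots
there are limits of elements of `A`. -/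
theorem closure_range_pow_mem_nhds_one {k : ℕ} (hk : k ≠ 0) :
    closure (Set.range fun a : A => a ^ k) ∈ 𝓝 (1 : A) := by
  let B := UniformSpace.Completion A
  have hunit : IsUnit (k : ℝ) := (Nat.cast_ne_zero.2 hk).isUnit
  let e : B ≃L[ℝ] B := ContinuousLinearEquiv.smulLeft hunit.unit
  have hd : HasStrictFDerivAt (fun y : B => y ^ k) (e : B →L[ℝ] B) 1 := by
    refine (hasStrictFDerivAt_pow (𝕜 := ℝ) k (x := (1 : B))).congr_fderiv ?_
    ext y
    simp [e, Units.smul_def, Algebra.smul_def]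

  have hmap := hd.map_nhds_eq_of_equiv
  have hrange : Set.range (fun y : B => y ^ k) ∈ 𝓝 (1 : B) := by
    rw [one_pow] at hmap
    rw [← hmap]
    exact range_mem_map
  have hind : IsInducing ((↑) : A → B) := UniformSpace.Completion.isUniformInducing_coe A |>.isInducing
  have hpre : ((↑) : A → B) ⁻¹' Set.range (fun y : B => y ^ k) ∈ 𝓝 (1 : A) :=
    hind.continuous.continuousAt.preimage_mem_nhds (by
      rwa [UniformSpace.Completion.coe_one])
  filter_upwards [hpre] with a ha
  obtain ⟨y, hy⟩ := ha
  rw [hind.closure_eq_preimage_closure_image]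
  have hd : closure (Set.range ((↑) : A → B)) = Set.univ :=
    UniformSpace.Completion.denseRange_coe.closure_range
  have := image_closure_subset_closure_image (continuous_pow k : Continuous fun y : B => y ^ k)
    (s := Set.range ((↑) : A → B))
  rw [hd] at this
  have hmem := this ⟨y, trivial, hy⟩
  refine closure_mono ?_ hmem
  rintro _ ⟨_, ⟨b, rfl⟩, rfl⟩
  exact ⟨b ^ k, ⟨b, rfl⟩, map_pow UniformSpace.Completion.coeRingHom b k⟩

end Seminormed

/-- The sums of `k`-th powers, as a subsemiring. -/
def sumsOfPowersSubsemiring (A : Type*) [CommRing A] (k : ℕ) : Subsemiring A :=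
  (MonoidHom.mrange (powMonoidHom k : A →* A)).subsemiringClosure

theorem coe_sumsOfPowersSubsemiring (A : Type*) [CommRing A] (k : ℕ) :
    (sumsOfPowersSubsemiring A k : Set A) = sumsOfPowers A k := by
  rw [sumsOfPowersSubsemiring, Submonoid.subsemiringClosure_coe]
  rfl

/-- For even exponents, an element on which all contractive characters are nonnegative is a limit
of sums of powers. -/
theorem mem_closure_sumsOfPowers {A : Type*} [SeminormedCommRing A] [NormedAlgebra ℝ A] {d : ℕ}
    (hd : 1 ≤ d) {f : A} (hf : ∀ α : A →ₐ[ℝ] ℝ, (∀ a, |α a| ≤ ‖a‖) → 0 ≤ α f) :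
    f ∈ closure (sumsOfPowers A (2 * d)) := by
  have hk : 2 * d ≠ 0 := by omega
  have hsub : Set.range (fun a : A => a ^ (2 * d)) ⊆ sumsOfPowers A (2 * d) :=
    AddSubmonoid.subset_closure
  rw [← coe_sumsOfPowersSubsemiring, ← Subsemiring.topologicalClosure_coe]
  refine mem_of_forall_contractive_algHom_nonneg
    (Subsemiring.isClosed_topologicalClosure _) (fun r hr => ?_) ?_ hf
  · refine Subsemiring.le_topologicalClosure _ ?_
    rw [← SetLike.mem_coe, coe_sumsOfPowersSubsemiring]
    refine hsub ⟨algebraMap ℝ A (r ^ ((2 * d : ℕ) : ℝ)⁻¹), ?_⟩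
    simp only
    rw [← map_pow, Real.rpow_inv_natCast_pow hr hk]
  · rw [Subsemiring.topologicalClosure_coe, coe_sumsOfPowersSubsemiring]
    exact mem_of_superset (closure_range_pow_mem_nhds_one hk) (closure_mono hsub)

/-! ### The `φ`-seminorm as an algebra seminorm -/

namespace SemigroupRing

theorem phiSeminorm_single {S : Type*} (φ : S → ℝ≥0) (s : S) (z : ℂ) :
    phiSeminorm φ (MonoidAlgebra.single s z) = ‖z‖ * φ s := by
  simp [phiSeminorm_apply]

theorem phiSeminorm_sum_le {S ι : Type*} (φ : S → ℝ≥0) (t : Finset ι) (f : ι → SemigroupRing S) :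
    phiSeminorm φ (∑ i ∈ t, f i) ≤ ∑ i ∈ t, phiSeminorm φ (f i) :=
  Finset.le_sum_of_subadditive _ (map_zero _).le (map_add_le_add _) _ _

variable {S : Type*} [CommMonoid S] [StarMul S] {φ : S → ℝ≥0}

theorem phiSeminorm_mul_le (hφ : IsSemigroupAbsoluteValue φ) (f g : SemigroupRing S) :
    phiSeminorm φ (f * g) ≤ phiSeminorm φ f * phiSeminorm φ g := by
  rw [MonoidAlgebra.mul_def, phiSeminorm_apply φ f, phiSeminorm_apply φ g]
  simp only [Finsupp.sum, Finset.sum_mul_sum]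
  refine (phiSeminorm_sum_le φ _ _).trans (Finset.sum_le_sum fun s _ => ?_)
  refine (phiSeminorm_sum_le φ _ _).trans (Finset.sum_le_sum fun t _ => ?_)
  have h : (φ (s * t) : ℝ) ≤ φ s * φ t := mod_cast hφ.map_mul_le s t
  rw [phiSeminorm_single, norm_mul, mul_mul_mul_comm]
  gcongr

theorem phiSeminorm_star_le (hφ : IsSemigroupAbsoluteValue φ) (f : SemigroupRing S) :
    phiSeminorm φ (star f) ≤ phiSeminorm φ f := by
  rw [star_def, phiSeminorm_apply φ f, Finsupp.sum, Finsupp.sum]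
  refine (phiSeminorm_sum_le φ _ _).trans (Finset.sum_le_sum fun s _ => ?_)
  rw [phiSeminorm_single, hφ.map_star, norm_star]

end SemigroupRing

namespace SymmetricPart

variable {S : Type*} [CommMonoid S] [StarMul S] {φ : S → ℝ≥0}

/-- `A_S` as a seminormed ring; its topology is `phiTopology φ` by definition. -/
@[reducible] def phiSeminormedCommRing (hφ : IsSemigroupAbsoluteValue φ) :
    SeminormedCommRing (SymmetricPart S) :=
  { (phiSeminorm φ).toSeminormedAddCommGroup,
    (inferInstance : CommRing (SymmetricPart S)) with
    norm_mul_le := fun f g => SemigroupRing.phiSeminorm_mul_le hφ f g }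

/-- `A_S` as a seminormed `ℝ`-algebra. -/
@[reducible] def phiNormedAlgebra (hφ : IsSemigroupAbsoluteValue φ) :
    @NormedAlgebra ℝ (SymmetricPart S) _ (phiSeminormedCommRing hφ).toSeminormedRing :=
  letI := phiSeminormedCommRing hφ
  { (inferInstance : Algebra ℝ (SymmetricPart S)) with
    norm_smul_le := fun r f => (map_smul_eq_mul (phiSeminorm φ) r f).le }

/-! ### Semicharacters and characters of `A_S` -/

/-- The real part `(f + f*) / 2` of `f`, as an element of `A_S`. -/
def re : SemigroupRing S →ₗ[ℝ] SymmetricPart S where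
  toFun f := ⟨realPart f, (realPart f).2⟩
  map_add' f g := Subtype.ext (by simp)
  map_smul' r f := Subtype.ext (by simp)

/-- The imaginary part `(f - f*) / (2 * I)` of `f`, as an element of `A_S`. -/
def im : SemigroupRing S →ₗ[ℝ] SymmetricPart S where
  toFun f := ⟨imaginaryPart f, (imaginaryPart f).2⟩
  map_add' f g := Subtype.ext (by simp)
  map_smul' r f := Subtype.ext (by simp)

theorem re_add_I_smul_im (f : SemigroupRing S) :
    (re f : SemigroupRing S) + Complex.I • (im f : SemigroupRing S) = f :=
  realPart_add_I_smul_imaginaryPart f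

theorem re_coe_add_I_smul (a b : SymmetricPart S) :
    re ((a : SemigroupRing S) + Complex.I • (b : SemigroupRing S)) = a := by
  have ha : IsSelfAdjoint (a : SemigroupRing S) := a.2
  have hb : IsSelfAdjoint (b : SemigroupRing S) := b.2
  refine Subtype.ext ?_
  change ((realPart _ : selfAdjoint (SemigroupRing S)) : SemigroupRing S) = a
  rw [map_add, realPart_I_smul, hb.imaginaryPart, neg_zero, add_zero, ha.coe_realPart]

theorem im_coe_add_I_smul (a b : SymmetricPart S) :
    im ((a : SemigroupRing S) + Complex.I • (b : SemigroupRing S)) = b := by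
  have ha : IsSelfAdjoint (a : SemigroupRing S) := a.2
  have hb : IsSelfAdjoint (b : SemigroupRing S) := b.2
  refine Subtype.ext ?_
  change ((imaginaryPart _ : selfAdjoint (SemigroupRing S)) : SemigroupRing S) = b
  rw [map_add, imaginaryPart_I_smul, ha.imaginaryPart, zero_add, hb.coe_realPart]

/-- The complexification `a + I • b ↦ α a + I * α b` of a character of `A_S`. -/
def complexify (α : SymmetricPart S →ₐ[ℝ] ℝ) (f : SemigroupRing S) : ℂ :=
  α (re f) + Complex.I * α (im f)

theorem complexify_coe_add_I_smul (α : SymmetricPart S →ₐ[ℝ] ℝ) (a b : SymmetricPart S) :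
    complexify α ((a : SemigroupRing S) + Complex.I • (b : SemigroupRing S)) =
      α a + Complex.I * α b := by
  rw [complexify, re_coe_add_I_smul, im_coe_add_I_smul]

theorem complexify_coe (α : SymmetricPart S →ₐ[ℝ] ℝ) (a : SymmetricPart S) :
    complexify α (a : SemigroupRing S) = α a := by
  simpa using complexify_coe_add_I_smul α a 0

theorem complexify_add (α : SymmetricPart S →ₐ[ℝ] ℝ) (f g : SemigroupRing S) :
    complexify α (f + g) = complexify α f + complexify α g := by
  simp only [complexify, map_add, Complex.ofReal_add]
  ring

theorem complexify_mul (α : SymmetricPart S →ₐ[ℝ] ℝ) (f g : SemigroupRing S) :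
    complexify α (f * g) = complexify α f * complexify α g := by
  have h : f * g = ((re f * re g - im f * im g : SymmetricPart S) : SemigroupRing S) +
      Complex.I • ((re f * im g + im f * re g : SymmetricPart S) : SemigroupRing S) := by
    nth_rewrite 1 [← re_add_I_smul_im f, ← re_add_I_smul_im g]
    push_cast
    simp only [add_mul, mul_add, smul_mul_assoc, mul_smul_comm, smul_add, smul_smul,
      Complex.I_mul_I, neg_smul, one_smul]
    abel
  rw [h, complexify_coe_add_I_smul, complexify, complexify]
  simp only [map_sub, map_add, map_mul, Complex.ofReal_add, Complex.ofReal_sub, Complex.ofReal_mul]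
  linear_combination (-(α (im f) : ℂ) * α (im g)) * Complex.I_mul_I

theorem complexify_star (α : SymmetricPart S →ₐ[ℝ] ℝ) (f : SemigroupRing S) :
    complexify α (star f) = star (complexify α f) := by
  have h : star f = (re f : SemigroupRing S) + Complex.I • ((-im f : SymmetricPart S) :
      SemigroupRing S) := by
    nth_rewrite 1 [← re_add_I_smul_im f]
    have h₁ : star (re f : SemigroupRing S) = re f := (re f).2
    have h₂ : star (im f : SemigroupRing S) = im f := (im f).2
    rw [star_add, star_smul, h₁, h₂]
    simp
  rw [h, complexify_coe_add_I_smul, complexify]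
  simp

theorem complexify_smul (α : SymmetricPart S →ₐ[ℝ] ℝ) (z : ℂ) (f : SemigroupRing S) :
    complexify α (z • f) = z * complexify α f := by
  have hre : re (Complex.I • f) = -im f := Subtype.ext (congrArg Subtype.val (realPart_I_smul f))
  have him : im (Complex.I • f) = re f :=
    Subtype.ext (congrArg Subtype.val (imaginaryPart_I_smul f))
  have hz : z • f = z.re • f + z.im • Complex.I • f := by
    nth_rewrite 1 [← Complex.re_add_im z]
    rw [add_smul, mul_smul, Complex.coe_smul, Complex.coe_smul]
  rw [hz]
  simp only [complexify, map_add, map_smul, hre, him, map_neg, smul_eq_mul, Complex.ofReal_add,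
    Complex.ofReal_mul, Complex.ofReal_neg]
  nth_rewrite 5 [← Complex.re_add_im z]
  linear_combination (-(z.im : ℂ) * α (im f)) * Complex.I_mul_I

/-- The semicharacter attached to a character of `A_S`. -/
def toSemicharacter (α : SymmetricPart S →ₐ[ℝ] ℝ) : Semicharacter S where
  toFun s := complexify α (MonoidAlgebra.single s 1)
  map_one' := by
    have := complexify_coe α 1
    rwa [map_one, OneMemClass.coe_one, MonoidAlgebra.one_def, Complex.ofReal_one] at this
  map_mul' s t := by
    rw [← complexify_mul, MonoidAlgebra.single_mul_single, one_mul]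
  map_star' s := by
    rw [← complexify_star, SemigroupRing.star_single, star_one]

theorem toStarAlgHom_toSemicharacter (α : SymmetricPart S →ₐ[ℝ] ℝ) (f : SemigroupRing S) :
    (toSemicharacter α).toStarAlgHom f = complexify α f := by
  induction f using MonoidAlgebra.induction_linear with
  | zero => simp [complexify]
  | add f g hf hg => rw [map_add, complexify_add, hf, hg]
  | single s z =>
    rw [Semicharacter.toStarAlgHom_apply, MonoidAlgebra.coeff_single,
      Finsupp.sum_single_index (by simp)]
    change z * complexify α _ = _
    rw [← complexify_smul, MonoidAlgebra.smul_single, smul_eq_mul, mul_one]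

theorem eval_toSemicharacter (α : SymmetricPart S →ₐ[ℝ] ℝ) (f : SymmetricPart S) :
    (toSemicharacter α).eval f = α f := by
  change ((toSemicharacter α).toStarAlgHom (f : SemigroupRing S)).re = α f
  rw [toStarAlgHom_toSemicharacter, complexify_coe, Complex.ofReal_re]

theorem phiSeminorm_re_le (hφ : IsSemigroupAbsoluteValue φ) (f : SemigroupRing S) :
    phiSeminorm φ (re f) ≤ SemigroupRing.phiSeminorm φ f := by
  have h : (re f : SemigroupRing S) = ((2⁻¹ : ℝ) : ℂ) • (f + star f) := by
    rw [Complex.coe_smul]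
    exact realPart_apply_coe f
  change SemigroupRing.phiSeminorm φ (re f : SemigroupRing S) ≤ _
  rw [h, map_smul_eq_mul, Complex.norm_real]
  have h₁ := map_add_le_add (SemigroupRing.phiSeminorm φ) f (star f)
  have h₂ := SemigroupRing.phiSeminorm_star_le hφ f
  norm_num
  linarith

/-- Rotating `single s 1` by a phase makes the value of the semicharacter real, hence equal to the
value of `α` at a real part. -/
theorem toSemicharacter_mem_boundedBy (hφ : IsSemigroupAbsoluteValue φ)
    {α : SymmetricPart S →ₐ[ℝ] ℝ} (hα : ∀ a, |α a| ≤ phiSeminorm φ a) :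
    toSemicharacter α ∈ Semicharacter.boundedBy φ := by
  intro s
  change ‖complexify α (MonoidAlgebra.single s 1)‖ ≤ _
  set w := complexify α (MonoidAlgebra.single s 1) with hw
  obtain ⟨u, hu, huw⟩ : ∃ u : ℂ, ‖u‖ = 1 ∧ u * w = ‖w‖ := by
    obtain ⟨u, hu, h⟩ := Complex.exists_norm_eq_mul_self w
    exact ⟨u, hu, h.symm⟩
  have h : complexify α (MonoidAlgebra.single s u) = ‖w‖ := by
    rw [← huw, hw, ← complexify_smul, MonoidAlgebra.smul_single, smul_eq_mul, mul_one]
  have hre : α (re (MonoidAlgebra.single s u)) = ‖w‖ := by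
    simpa [complexify] using congrArg Complex.re h
  rw [← hre]
  refine (le_abs_self _).trans ((hα _).trans ((phiSeminorm_re_le hφ _).trans ?_))
  rw [SemigroupRing.phiSeminorm_single, hu, one_mul]

end SymmetricPart

/-! ### The cone `Pos(K_φ)` -/

namespace Semicharacter

variable {S : Type*} [CommMonoid S] [StarMul S] {φ : S → ℝ≥0}

theorem abs_eval_le {α : Semicharacter S} (hα : α ∈ boundedBy φ) (f : SymmetricPart S) :
    |α.eval f| ≤ SymmetricPart.phiSeminorm φ f := by
  rw [← Real.norm_eq_abs, ← Complex.norm_real, coe_eval, SymmetricPart.phiSeminorm_apply,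
    Finsupp.sum, Finsupp.sum]
  refine (norm_sum_le _ _).trans (Finset.sum_le_sum fun s _ => ?_)
  rw [norm_mul]
  exact mul_le_mul_of_nonneg_left (hα s) (norm_nonneg _)

theorem isClosed_Pos_boundedBy (φ : S → ℝ≥0) :
    @IsClosed _ (SymmetricPart.phiTopology φ) (Pos (boundedBy φ)) := by
  let := (SymmetricPart.phiSeminorm (S := S) φ).toSeminormedAddCommGroup
  have h : Pos (boundedBy φ) = ⋂ α ∈ boundedBy φ, {f : SymmetricPart S | 0 ≤ α.eval f} := by
    ext f
    simp [Pos]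
  change IsClosed (Pos (boundedBy φ))
  rw [h]
  refine isClosed_biInter fun α hα => isClosed_le continuous_const ?_
  exact AddMonoidHomClass.continuous_of_bound (α.eval : SymmetricPart S →+ ℝ) 1 fun f => by
    rw [one_mul]
    exact abs_eval_le hα f

theorem sumsOfPowers_subset_Pos (K : Set (Semicharacter S)) (d : ℕ) :
    sumsOfPowers (SymmetricPart S) (2 * d) ⊆ Pos K := by
  intro f hf α _
  refine AddSubmonoid.closure_induction (motive := fun f _ => 0 ≤ α.eval f) ?_ ?_ ?_ hf
  · rintro _ ⟨a, rfl⟩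
    simp only [map_pow]
    exact (even_two_mul d).pow_nonneg _
  · simp
  · intro a b _ _ ha hb
    rw [map_add]
    exact add_nonneg ha hb

end Semicharacter

end

theorem mainTheorem2 {S : Type*} [CommMonoid S] [StarMul S] (φ : S → ℝ≥0)
    (hφ : IsSemigroupAbsoluteValue φ) (d : ℕ) (hd : 1 ≤ d) :
    @closure (SymmetricPart S) (SymmetricPart.phiTopology φ)
      (sumsOfPowers (SymmetricPart S) (2 * d)) =
    Semicharacter.Pos (Semicharacter.boundedBy φ) := by
  refine Set.Subset.antisymm ?_ fun f hf => ?_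
  · exact @closure_minimal _ (SymmetricPart.phiTopology φ) _ _
      (Semicharacter.sumsOfPowers_subset_Pos _ d) (Semicharacter.isClosed_Pos_boundedBy φ)
  · let := SymmetricPart.phiSeminormedCommRing hφ
    let := SymmetricPart.phiNormedAlgebra hφ
    refine mem_closure_sumsOfPowers (A := SymmetricPart S) hd fun α hα => ?_
    have := hf _ (SymmetricPart.toSemicharacter_mem_boundedBy hφ hα)
    rwa [SymmetricPart.eval_toSemicharacter] at this
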